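/- Let $\mathbb K$ be a field of characteristic zero and let $G$ be a finite graph on the vertex set $\{0,1,\dots,n\}$; multiple edges are allowed, loops are not. Let $\Phi_G$ be the commutative $\mathbb K$-algebra generated by variables $\phi_e$, one for each edge $e$ of $G$, with defining relations $\phi_e^2=0$. For $i=0,\dots,n$ put $$X_i=\sum_{e} c_{i,e}\,\phi_e,\qquad c_{i,e}=\begin{cases}1 & \text{if } e=(i,j),\ i<j,\\ -1 & \text{if } e=(i,j),\ i>j,\\ 0 & \text{otherwise,}\end{cases}\qquad Y_i=\exp(X_i)=\prod_e (1+c_{i,e}\phi_e),$$ and let $\mathcal K_G\subset\Phi_G$ be the subalgebra generated by $Y_0,\dots,Y_n$. For a nonempty subset $I\subseteq\{0,\dots,n\}$ let $D_I$ be the number of edges of $G$ joining a vertex of $I$ to a vertex outside $I$, and let $$\mathcal D_G=\mathbb K[y_0,\dots,y_n]\Big/\Big(\big(\textstyle\prod_{i\in I}y_i-1\big)^{D_I+1}\ :\ \emptyset\ne I\subseteq\{0,\dots,n\}\Big).$$ Filter $\mathcal D_G$ and $\mathcal K_G$ by degree in the given generators: for $k\ge 0$, $F_k\mathcal D_G$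 (respectively $F_k\mathcal K_G$) is the set of all values of polynomials over $\mathbb K$ of total degree at most $k$ at the classes of $y_0,\dots,y_n$ (respectively at $Y_0,\dots,Y_n$). Then $\mathcal D_G$ and $\mathcal K_G$ are isomorphic as filtered algebras. More precisely, there is an isomorphism of $\mathbb K$-algebras $h:\mathcal D_G\to\mathcal K_G$ with $h(y_i)=Y_i$ for $i=0,\dots,n$, and $h(F_k\mathcal D_G)=F_k\mathcal K_G$ for all $k\ge 0$. -/

import Mathlib

open scoped Graph

namespace GraphAlg

noncomputable section

/-- The algebra `Φ_G`: commutative `K`-algebra on variables `φ_e`, one for each edge `e` of `G`,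
with relations `φ_e ^ 2 = 0`. -/
abbrev Phi (K : Type*) [Field K] {α ε : Type*} (G : Graph α ε) : Type _ :=
  MvPolynomial E(G) K ⧸
    Ideal.span (Set.range fun e : E(G) => (MvPolynomial.X e : MvPolynomial E(G) K) ^ 2)

/-- The generator `φ_e` of `Φ_G`. -/
def phi (K : Type*) [Field K] {α ε : Type*} (G : Graph α ε) (e : E(G)) : Phi K G :=
  Ideal.Quotient.mk _ (MvPolynomial.X e)

open Classical in
/-- The signs `c_{i,e}`: `1` if `e = (i,j)` with `i < j`, `-1` if `e = (i,j)` with `i > j`, and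
`0` otherwise. -/
def coeff (K : Type*) [Field K] {n : ℕ} {ε : Type*} (G : Graph (Fin (n + 1)) ε)
    (i : Fin (n + 1)) (e : E(G)) : K :=
  if ∃ j, G.IsLink e.1 i j ∧ i < j then 1
  else if ∃ j, G.IsLink e.1 i j ∧ j < i then -1
  else 0

/-- `X_i = ∑_e c_{i,e} φ_e`. -/
def X (K : Type*) [Field K] {n : ℕ} {ε : Type*} (G : Graph (Fin (n + 1)) ε) [Fintype E(G)]
    (i : Fin (n + 1)) : Phi K G :=
  ∑ e : E(G), coeff K G i e • phi K G e

/-- `Y_i = exp (X_i)`; the element `X_i` is nilpotent, so the exponential series is finite. -/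
def Y (K : Type*) [Field K] [CharZero K] {n : ℕ} {ε : Type*} (G : Graph (Fin (n + 1)) ε)
    [Fintype E(G)] (i : Fin (n + 1)) : Phi K G :=
  IsNilpotent.exp (X K G i)

/-- The algebra `K_G`: the subalgebra of `Φ_G` generated by `Y_0, …, Y_n`. -/
def KAlg (K : Type*) [Field K] [CharZero K] {n : ℕ} {ε : Type*} (G : Graph (Fin (n + 1)) ε)
    [Fintype E(G)] : Subalgebra K (Phi K G) :=
  Algebra.adjoin K (Set.range (Y K G))

/-- `Y_i` as an element of `K_G`. -/
def KAlg.gen (K : Type*) [Field K] [CharZero K] {n : ℕ} {ε : Type*}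
    (G : Graph (Fin (n + 1)) ε) [Fintype E(G)] (i : Fin (n + 1)) : KAlg K G :=
  ⟨Y K G i, Algebra.subset_adjoin (Set.mem_range_self i)⟩

/-- `D_I`: the number of edges of `G` between `I` and the complement of `I`. -/
def cut {α ε : Type*} (G : Graph α ε) (I : Finset α) : ℕ :=
  {e : ε | ∃ i ∈ I, ∃ j ∉ I, G.IsLink e i j}.ncard

/-- The polynomial `q_I = (∏_{i ∈ I} y_i - 1) ^ (D_I + 1)`. -/
def q (K : Type*) [Field K] {n : ℕ} {ε : Type*} (G : Graph (Fin (n + 1)) ε)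
    (I : Finset (Fin (n + 1))) : MvPolynomial (Fin (n + 1)) K :=
  (∏ i ∈ I, MvPolynomial.X i - 1) ^ (cut G I + 1)

/-- The algebra `D_G`: the quotient of `K[y_0, …, y_n]` by the ideal generated by all `q_I`,
where `I` ranges over the nonempty subsets of `{0, …, n}`. -/
abbrev DAlg (K : Type*) [Field K] {n : ℕ} {ε : Type*} (G : Graph (Fin (n + 1)) ε) : Type _ :=
  MvPolynomial (Fin (n + 1)) K ⧸
    Ideal.span {p | ∃ I : Finset (Fin (n + 1)), I.Nonempty ∧ p = q K G I}

/-- The class of `y_i` in `D_G`. -/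
def DAlg.gen (K : Type*) [Field K] {n : ℕ} {ε : Type*} (G : Graph (Fin (n + 1)) ε)
    (i : Fin (n + 1)) : DAlg K G :=
  Ideal.Quotient.mk _ (MvPolynomial.X i)

/-- The increasing filtration of a commutative algebra `A` defined by a family `a` of generators:
its `k`-th term consists of all values at `a` of polynomials of total degree at most `k`. -/
def genFiltration (K : Type*) [Field K] {σ A : Type*} [CommRing A] [Algebra K A] (a : σ → A)
    (k : ℕ) : Submodule K A :=
  (MvPolynomial.restrictTotalDegree σ K k).map (MvPolynomial.aeval a).toLinearMap

theorem phi_sq (K : Type*) [Field K] {α ε : Type*} (G : Graph α ε) (e : E(G)) :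
    phi K G e ^ 2 = 0 := by
  rw [phi, ← map_pow, Ideal.Quotient.eq_zero_iff_mem]
  exact Ideal.subset_span ⟨e, rfl⟩

theorem term_sq (K : Type*) [Field K] {n : ℕ} {ε : Type*} (G : Graph (Fin (n + 1)) ε)
    (i : Fin (n + 1)) (e : E(G)) : (coeff K G i e • phi K G e) ^ 2 = 0 := by
  rw [smul_pow, phi_sq, smul_zero]

theorem isNilpotent_X (K : Type*) [Field K] {n : ℕ} {ε : Type*}
    (G : Graph (Fin (n + 1)) ε) [Fintype E(G)] (i : Fin (n + 1)) : IsNilpotent (X K G i) :=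
  isNilpotent_sum fun e _ => ⟨2, term_sq K G i e⟩

/-- The other description of `Y_i`: `exp (X_i) = ∏_e (1 + c_{i,e} φ_e)`. -/
theorem Y_eq_prod (K : Type*) [Field K] [CharZero K] {n : ℕ} {ε : Type*}
    (G : Graph (Fin (n + 1)) ε) [Fintype E(G)] (i : Fin (n + 1)) :
    Y K G i = ∏ e : E(G), (1 + coeff K G i e • phi K G e) := by
  classical
  have key : ∀ s : Finset E(G),
      IsNilpotent.exp (∑ e ∈ s, coeff K G i e • phi K G e) =
        ∏ e ∈ s, (1 + coeff K G i e • phi K G e) := by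
    intro s
    induction s using Finset.induction_on with
    | empty => simp
    | insert e s he ih =>
      rw [Finset.sum_insert he, Finset.prod_insert he,
        IsNilpotent.exp_add_of_commute (Commute.all _ _) ⟨2, term_sq K G i e⟩
          (isNilpotent_sum fun e _ => ⟨2, term_sq K G i e⟩), ih,
        IsNilpotent.exp_eq_sum (term_sq K G i e)]
      simp [Finset.sum_range_succ]
  exact key Finset.univ

end

end GraphAlg

namespace GraphAlg

noncomputable section


/-! The relations of `D_G` are those of the Postnikov-Shapiro algebra, generated by the `X_i`, in
exponential coordinates. Each `y_i - 1` is nilpotent in `D_G`, so `y_i = exp x_i` with `x_i`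
nilpotent. As `exp z - 1` is `z` times a unit, the defining relations become `(∑_{i ∈ I} x_i) ^ (D_I
+ 1) = 0`. The map `y_i ↦ Y_i` sends `x_i` to `X_i`, and the `x_i` generate `D_G`. Injectivity thus
reduces to the claim that these powers generate all relations between the `X_i`
(`mem_powerIdeal_cutCard`).

That claim is proved by apolarity. A polynomial `p` lies in the power ideal once it is orthogonal to
every `f` of degree at most `D_I` along the indicator vector of each `I`. By deletion and
contraction, such `f` are spanned by products of `X a - X b` over sets of edges
(`mem_span_prod_of_iterate_dirDeriv`). Pairing `p` with such a product gives a squarefree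
coefficient of `p(X_0, …, X_n)` (`coeff_squarefree_aeval_linForm`), which is zero when `p` is a
relation.

The isomorphism matches generators, so it matches the filtrations. -/

open MvPolynomial in
/-- The linear form `∑ v, c v * X v`. -/
def linForm {K V : Type*} [Field K] [Fintype V] (c : V → K) : MvPolynomial V K :=
  ∑ v, C (c v) * MvPolynomial.X v

/-- The directional derivative along the vector `c`. -/
def dirDeriv {K V : Type*} [Field K] (c : V → K) :
    Derivation K (MvPolynomial V K) (MvPolynomial V K) :=
  MvPolynomial.mkDerivation K fun v => MvPolynomial.C (c v)

open Classical in
/-- The indicator vector of a finite set. -/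
def indVec (K : Type*) [Field K] {V : Type*} (I : Finset V) (v : V) : K :=
  if v ∈ I then 1 else 0

open Classical in
/-- The number of pairs `(a e, b e)`, `e ∈ s`, which are separated by `I`. -/
def cutCard {V ι : Type*} (s : Finset ι) (a b : ι → V) (I : Finset V) : ℕ :=
  (s.filter fun e => ¬(a e ∈ I ↔ b e ∈ I)).card

/-! ### Iterated derivations and degree along a vector. -/

section Derivation

variable {R A : Type*} [CommRing R] [CommRing A] [Algebra R A]

/-- Since `D (D l) = 0`, only two terms of the iterated Leibniz rule survive. -/
theorem iterate_succ_derivation_mul (D : Derivation R A A) {l : A} {c : R}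
    (hl : D l = algebraMap R A c) (g : A) (k : ℕ) :
    D^[k + 1] (l * g) = l * D^[k + 1] g + ((k + 1 : ℕ) * c) • D^[k] g := by
  induction k with
  | zero => simp [hl, Algebra.smul_def, mul_comm]
  | succ k ih =>
    rw [Function.iterate_succ_apply', ih, map_add, D.leibniz, D.map_smul, hl,
      ← Function.iterate_succ_apply' (f := D) (n := k + 1), smul_eq_mul, smul_eq_mul,
      ← Function.iterate_succ_apply' (f := D) (n := k)]
    simp only [Algebra.smul_def, map_mul, map_natCast]
    push_cast
    ring

theorem iterate_derivation_mul_of_eq_zero (D : Derivation R A A) {l : A} (hl : D l = 0)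
    (g : A) (k : ℕ) : D^[k] (l * g) = l * D^[k] g := by
  induction k with
  | zero => rfl
  | succ k ih => rw [Function.iterate_succ_apply', ih, D.leibniz, hl, smul_zero, add_zero,
      smul_eq_mul, ← Function.iterate_succ_apply' (f := D) (n := k)]

end Derivation

section Polynomial

variable {K V : Type*} [Field K]

theorem iterate_eq_zero_of_le {A F : Type*} [Zero A] [FunLike F A A] [ZeroHomClass F A A]
    (D : F) {f : A} {m k : ℕ} (hmk : m ≤ k) (h : D^[m] f = 0) : D^[k] f = 0 := by
  obtain ⟨d, rfl⟩ := Nat.exists_eq_add_of_le' hmk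
  rw [Function.iterate_add_apply, h]
  exact Function.iterate_fixed (map_zero D) d

@[simp]
theorem dirDeriv_X (c : V → K) (v : V) : dirDeriv c (MvPolynomial.X v) = MvPolynomial.C (c v) := by
  simp [dirDeriv]

theorem exists_iterate_dirDeriv_eq_zero (c : V → K) (f : MvPolynomial V K) :
    ∃ N, (dirDeriv c)^[N] f = 0 := by
  induction f using MvPolynomial.induction_on with
  | C r => exact ⟨1, by simp⟩
  | add p q hp hq =>
    obtain ⟨M, hM⟩ := hp
    obtain ⟨N, hN⟩ := hq
    refine ⟨M + N, ?_⟩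
    rw [iterate_map_add, iterate_eq_zero_of_le _ (Nat.le_add_right M N) hM,
      iterate_eq_zero_of_le _ (Nat.le_add_left N M) hN, add_zero]
  | mul_X p v hp =>
    obtain ⟨N, hN⟩ := hp
    refine ⟨N + 1, ?_⟩
    rw [mul_comm, iterate_succ_derivation_mul (dirDeriv c) (dirDeriv_X c v),
      iterate_eq_zero_of_le _ (Nat.le_succ N) hN, hN, mul_zero, smul_zero, add_zero]

/-- Multiplication by a linear form that is not constant along `c` raises the degree along `c`. -/
theorem iterate_dirDeriv_eq_zero_of_mul [CharZero K] {c : V → K} {l g : MvPolynomial V K} {r : K}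
    (hr : r ≠ 0) (hl : dirDeriv c l = MvPolynomial.C r) {m : ℕ}
    (h : (dirDeriv c)^[m + 1] (l * g) = 0) : (dirDeriv c)^[m] g = 0 := by
  obtain ⟨N, hN⟩ := exists_iterate_dirDeriv_eq_zero c g
  -- Descend from an order that kills `g`: in the two-term Leibniz rule the first term is zero, and
  -- the other has the nonzero factor `(m + d + 1) * r`.
  have key : ∀ d, (dirDeriv c)^[m + d] g = 0 → (dirDeriv c)^[m] g = 0 := by
    intro d
    induction d with
    | zero => exact id
    | succ d ih =>
      intro hd
      refine ih ?_
      have h1 := iterate_succ_derivation_mul (dirDeriv c) hl g (m + d)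
      rw [iterate_eq_zero_of_le _ (by omega) h, show m + d + 1 = m + (d + 1) by ring, hd,
        mul_zero, zero_add] at h1
      exact (smul_eq_zero.mp h1.symm).resolve_left
        (mul_ne_zero (Nat.cast_ne_zero.mpr (by omega)) hr)
  exact key N (iterate_eq_zero_of_le _ (Nat.le_add_left N m) hN)

theorem dirDeriv_rename (c : V → K) (π : V → V) (f : MvPolynomial V K) :
    dirDeriv c (MvPolynomial.rename π f) = MvPolynomial.rename π (dirDeriv (c ∘ π) f) := by
  induction f using MvPolynomial.induction_on with
  | C r => simp
  | add p q hp hq => simp [hp, hq]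
  | mul_X p v hp => simp [Derivation.leibniz, hp]

theorem iterate_dirDeriv_rename (c : V → K) (π : V → V) (f : MvPolynomial V K) (k : ℕ) :
    (dirDeriv c)^[k] (MvPolynomial.rename π f) =
      MvPolynomial.rename π ((dirDeriv (c ∘ π))^[k] f) := by
  induction k with
  | zero => rfl
  | succ k ih => rw [Function.iterate_succ_apply', ih, dirDeriv_rename,
      Function.iterate_succ_apply']

/-- Identifying the two variables is reduction modulo their difference. -/
theorem X_sub_X_dvd_sub_rename_update [DecidableEq V] (a b : V) (f : MvPolynomial V K) :
    (MvPolynomial.X a - MvPolynomial.X b) ∣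
      f - MvPolynomial.rename (Function.update id b a) f := by
  induction f using MvPolynomial.induction_on with
  | C r => simp
  | add p q hp hq => rw [map_add, add_sub_add_comm]; exact dvd_add hp hq
  | mul_X p v hp =>
    rw [map_mul, MvPolynomial.rename_X]
    have h2 : (MvPolynomial.X a - MvPolynomial.X b : MvPolynomial V K) ∣
        MvPolynomial.X v - MvPolynomial.X (Function.update id b a v) := by
      by_cases hv : v = b
      · subst hv
        rw [Function.update_self]
        exact ⟨-1, by ring⟩
      · simp [Function.update_of_ne hv]
    have := dvd_add (hp.mul_right (MvPolynomial.X v))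
      (h2.mul_left (MvPolynomial.rename (Function.update id b a) p))
    convert this using 1
    ring

theorem eq_C_of_forall_dirDeriv_eq_zero [CharZero K] {f : MvPolynomial V K}
    (h : ∀ v, dirDeriv (indVec K {v}) f = 0) :
    f = MvPolynomial.C (MvPolynomial.coeff 0 f) := by
  classical
  ext m
  rw [MvPolynomial.coeff_C]
  split_ifs with hm
  · rw [hm]
  · obtain ⟨v, hv⟩ := Finsupp.ne_iff.mp (Ne.symm hm)
    have hd : dirDeriv (indVec K {v}) = MvPolynomial.pderiv v := by
      refine MvPolynomial.derivation_ext fun w => ?_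
      by_cases hw : w = v
      · subst hw; simp [indVec]
      · simp [indVec, hw, MvPolynomial.pderiv_X_of_ne hw]
    have h1 := congrArg (MvPolynomial.coeff (m - Finsupp.single v 1)) (h v)
    rw [hd, MvPolynomial.coeff_pderiv, MvPolynomial.coeff_zero,
      tsub_add_cancel_of_le (by simpa [Nat.one_le_iff_ne_zero] using hv)] at h1
    exact (mul_eq_zero.mp h1).resolve_right (Nat.cast_add_one_ne_zero _)

end Polynomial

/-! ### Cuts and the span of edge products. -/

section Cut

variable {V ι : Type*}

theorem cutCard_insert_of_separated [DecidableEq ι] {s : Finset ι} {e : ι} (he : e ∉ s) {a b : ι → V}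
    {I : Finset V} (h : ¬(a e ∈ I ↔ b e ∈ I)) :
    cutCard (insert e s) a b I = cutCard s a b I + 1 := by
  rw [cutCard, Finset.filter_insert, if_pos h, Finset.card_insert_of_notMem (by simp [he]), cutCard]

theorem cutCard_insert_of_not_separated [DecidableEq ι] {s : Finset ι} {e : ι} {a b : ι → V}
    {I : Finset V} (h : a e ∈ I ↔ b e ∈ I) :
    cutCard (insert e s) a b I = cutCard s a b I := by
  rw [cutCard, Finset.filter_insert, if_neg (by simpa using h), cutCard]

theorem cutCard_comp [Fintype V] [DecidableEq V] (s : Finset ι) (a b : ι → V) (π : V → V)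
    (I : Finset V) :
    cutCard s (π ∘ a) (π ∘ b) I = cutCard s a b (Finset.univ.filter fun v => π v ∈ I) := by
  simp [cutCard]

theorem cutCard_mono {s t : Finset ι} (h : s ⊆ t) (a b : ι → V) (I : Finset V) :
    cutCard s a b I ≤ cutCard t a b I := by
  classical exact Finset.card_le_card (Finset.filter_subset_filter _ h)

/-- A factor is constant along `I` unless its edge is cut, so the degree along `I` is at most the
number of cut edges. -/
theorem iterate_dirDeriv_prod {K : Type*} [Field K] (s : Finset ι) (a b : ι → V) (I : Finset V) :
    (dirDeriv (indVec K I))^[cutCard s a b I + 1]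
      (∏ e ∈ s, (MvPolynomial.X (a e) - MvPolynomial.X (b e))) = 0 := by
  classical
  induction s using Finset.induction_on with
  | empty => simp [cutCard]
  | insert e s he ih =>
    rw [Finset.prod_insert he]
    by_cases hsep : a e ∈ I ↔ b e ∈ I
    · rw [cutCard_insert_of_not_separated hsep, iterate_derivation_mul_of_eq_zero _
        (by simp [indVec, hsep]), ih, mul_zero]
    · rw [cutCard_insert_of_separated he hsep, iterate_succ_derivation_mul
        (c := indVec K I (a e) - indVec K I (b e)) _ (by simp), ih,
        iterate_eq_zero_of_le _ (Nat.le_succ _) ih, mul_zero, smul_zero, add_zero]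

theorem iterate_dirDeriv_eq_zero_of_mem_span {K : Type*} [Field K] {s : Finset ι} {a b : ι → V}
    {f : MvPolynomial V K}
    (hf : f ∈ Submodule.span K
      ((fun S : Finset ι => ∏ e ∈ S, (MvPolynomial.X (a e) - MvPolynomial.X (b e))) ''
        {S | S ⊆ s})) (I : Finset V) :
    (dirDeriv (indVec K I))^[cutCard s a b I + 1] f = 0 := by
  induction hf using Submodule.span_induction with
  | mem f hf =>
    obtain ⟨S, hS, rfl⟩ := hf
    exact iterate_eq_zero_of_le _ (Nat.succ_le_succ (cutCard_mono hS a b I))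
      (iterate_dirDeriv_prod S a b I)
  | zero => exact iterate_map_zero _ _
  | add f g _ _ hf hg => rw [iterate_map_add, hf, hg, add_zero]
  | smul r f _ hf =>
    rw [show (dirDeriv (indVec K I))^[cutCard s a b I + 1] (r • f) =
      r • (dirDeriv (indVec K I))^[cutCard s a b I + 1] f from
        (Function.Commute.iterate_left (fun p => (dirDeriv (indVec K I)).map_smul r p) _) f,
      hf, smul_zero]

end Cut

/-- A polynomial whose degree along the indicator vector of every `I` is at most the number of
edges in `s` separated by `I` is a linear combination of products over subsets of `s` of the
linear forms `X (a e) - X (b e)`. -/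
theorem mem_span_prod_of_iterate_dirDeriv {K V ι : Type*} [Field K] [CharZero K] [Fintype V]
    (s : Finset ι) (a b : ι → V) (f : MvPolynomial V K)
    (h : ∀ I : Finset V, (dirDeriv (indVec K I))^[cutCard s a b I + 1] f = 0) :
    f ∈ Submodule.span K
      ((fun S : Finset ι => ∏ e ∈ S, (MvPolynomial.X (a e) - MvPolynomial.X (b e))) ''
        {S | S ⊆ s}) := by
  classical
  induction s using Finset.induction_on generalizing a b f with
  | empty =>
    have := eq_C_of_forall_dirDeriv_eq_zero fun v => h {v}
    rw [this, ← mul_one (MvPolynomial.C _), ← MvPolynomial.smul_eq_C_mul]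
    exact Submodule.smul_mem _ _ (Submodule.subset_span ⟨∅, by simp, by simp⟩)
  | insert e s he ih =>
    -- Contraction can create loops; no `I` separates a loop, so it is dropped.
    by_cases hab : a e = b e
    · refine Submodule.span_mono (Set.image_mono fun S hS => hS.trans (Finset.subset_insert e s))
        (ih a b f fun I => ?_)
      have := h I
      rwa [cutCard_insert_of_not_separated (by rw [hab])] at this
    -- Contract `e`. A preimage under `π` contains both ends of `e` or neither, so the bounds on `f`
    -- restrict to bounds for the contracted graph.
    set π : V → V := Function.update id (b e) (a e) with hπ
    have hπa : π (a e) = a e := by rw [hπ, Function.update_of_ne hab, id]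
    have hπb : π (b e) = a e := Function.update_self ..
    have hπf := ih (π ∘ a) (π ∘ b) (MvPolynomial.rename π f) fun I => by
      rw [iterate_dirDeriv_rename, cutCard_comp]
      have := h (Finset.univ.filter fun v => π v ∈ I)
      rw [cutCard_insert_of_not_separated (by simp [hπa, hπb])] at this
      have hc : indVec K I ∘ π = indVec K (Finset.univ.filter fun v => π v ∈ I) := by
        ext v; simp [indVec]
      rw [hc, this, map_zero]
    -- Edge products of the contraction are images of edge products over `s`, so the contracted `f`
    -- lifts to the span.
    obtain ⟨f', hf', hff'⟩ : ∃ f' ∈ Submodule.span K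
        ((fun S : Finset ι => ∏ e ∈ S, (MvPolynomial.X (a e) - MvPolynomial.X (b e))) ''
          {S | S ⊆ s}), MvPolynomial.rename π f' = (MvPolynomial.rename π f : MvPolynomial V K) := by
      have : Submodule.span K
        ((fun S : Finset ι => ∏ e ∈ S, (MvPolynomial.X ((π ∘ a) e) -
          (MvPolynomial.X ((π ∘ b) e) : MvPolynomial V K))) '' {S | S ⊆ s}) =
        (Submodule.span K
        ((fun S : Finset ι => ∏ e ∈ S, (MvPolynomial.X (a e) - MvPolynomial.X (b e))) ''
          {S | S ⊆ s})).map (MvPolynomial.rename (R := K) π).toLinearMap := by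
        rw [Submodule.map_span, Set.image_image]
        simp
      rw [this] at hπf
      exact hπf
    obtain ⟨g, hg⟩ : (MvPolynomial.X (a e) - MvPolynomial.X (b e)) ∣ f - f' := by
      have h1 := X_sub_X_dvd_sub_rename_update (a e) (b e) (f - f')
      rwa [map_sub, hff', sub_self, sub_zero] at h1
    -- Deletion: if `I` cuts `e`, both the allowed degree and the degree of the quotient drop by
    -- one; otherwise the factor is a nonzero constant for the derivation and cancels.
    have hgs := ih a b g fun I => by
      have h1 : (dirDeriv (indVec K I))^[cutCard (insert e s) a b I + 1]
          ((MvPolynomial.X (a e) - MvPolynomial.X (b e)) * g) = 0 := by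
        rw [← hg, iterate_map_sub, h I, iterate_eq_zero_of_le _
          (by simpa using cutCard_mono (Finset.subset_insert e s) a b I)
          (iterate_dirDeriv_eq_zero_of_mem_span hf' I), sub_zero]
      by_cases hsep : a e ∈ I ↔ b e ∈ I
      · rw [cutCard_insert_of_not_separated hsep, iterate_derivation_mul_of_eq_zero _
          (by simp [indVec, hsep])] at h1
        exact (mul_eq_zero.mp h1).resolve_left
          (sub_ne_zero.mpr fun h => hab (MvPolynomial.X_injective h))
      · rw [cutCard_insert_of_separated he hsep] at h1
        refine iterate_dirDeriv_eq_zero_of_mul (r := indVec K I (a e) - indVec K I (b e)) ?_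
          (by simp) h1
        by_cases ha : a e ∈ I <;> by_cases hb : b e ∈ I <;> simp_all [indVec]
    rw [← sub_add_cancel f f', hg]
    refine Submodule.add_mem _ ?_ (Submodule.span_mono
      (Set.image_mono fun S hS => hS.trans (Finset.subset_insert e s)) hf')
    have h2 := Submodule.mem_map_of_mem (f := LinearMap.mulLeft K
      (MvPolynomial.X (a e) - MvPolynomial.X (b e) : MvPolynomial V K)) hgs
    rw [Submodule.map_span, Set.image_image] at h2
    refine Submodule.span_mono ?_ h2
    rintro _ ⟨S, hS, rfl⟩
    refine ⟨insert e S, Finset.insert_subset_insert e hS, ?_⟩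
    simp only [LinearMap.mulLeft_apply]
    rw [Finset.prod_insert fun h => he (hS h)]


/-! ### The apolar pairing. -/

section Pairing

variable {K V : Type*} [Field K] [Fintype V]

/-- The apolar pairing, for which the monomials are orthogonal and the square of `X ^ m` is
`∏ v, (m v)!`. -/
def apolar : MvPolynomial V K →ₗ[K] MvPolynomial V K →ₗ[K] K :=
  (MvPolynomial.basisMonomials V K).constr K fun m =>
    ((∏ v, (m v).factorial : ℕ) : K) • MvPolynomial.lcoeff K m

theorem apolar_monomial (m : V →₀ ℕ) (r : K) (f : MvPolynomial V K) :
    apolar (MvPolynomial.monomial m r) f =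
      r * (∏ v, (m v).factorial : ℕ) * MvPolynomial.coeff m f := by
  have h : MvPolynomial.monomial m r = r • MvPolynomial.basisMonomials V K m := by
    simp [MvPolynomial.smul_monomial]
  rw [h, map_smul, apolar, Module.Basis.constr_basis]
  simp [mul_assoc]

theorem apolar_comm (f g : MvPolynomial V K) : apolar f g = apolar g f := by
  classical
  induction f using MvPolynomial.induction_on' with
  | add p q hp hq => simp [hp, hq]
  | monomial m r =>
    induction g using MvPolynomial.induction_on' with
    | add p q hp hq => simp [hp, hq]
    | monomial m' r' =>
      rw [apolar_monomial, apolar_monomial, MvPolynomial.coeff_monomial,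
        MvPolynomial.coeff_monomial]
      by_cases h : m = m'
      · subst h; simp; ring
      · simp [h, Ne.symm h]

/-- The factorial weights make multiplication by a variable adjoint to differentiation. -/
theorem apolar_X_mul (v : V) (p f : MvPolynomial V K) :
    apolar (MvPolynomial.X v * p) f = apolar p (MvPolynomial.pderiv v f) := by
  classical
  induction p using MvPolynomial.induction_on' with
  | add p q hp hq => simp [mul_add, hp, hq]
  | monomial m r =>
    have h : ∏ w, ((m + Finsupp.single v 1 : V →₀ ℕ) w).factorial = (m v + 1) * ∏ w, (m w).factorial := by
      rw [← Finset.mul_prod_erase _ _ (Finset.mem_univ v),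
        ← Finset.mul_prod_erase _ (fun w => (m w).factorial) (Finset.mem_univ v), ← mul_assoc]
      congr 1
      · simp [Nat.factorial_succ]
      · refine Finset.prod_congr rfl fun w hw => ?_
        simp [(Finset.ne_of_mem_erase hw).symm]
    rw [mul_comm, MvPolynomial.X, MvPolynomial.monomial_mul, apolar_monomial, apolar_monomial, h,
      MvPolynomial.coeff_pderiv]
    push_cast
    ring

theorem dirDeriv_eq_sum (c : V → K) (f : MvPolynomial V K) :
    dirDeriv c f = ∑ v, c v • MvPolynomial.pderiv v f := by
  classical
  induction f using MvPolynomial.induction_on with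
  | C r => simp
  | add p q hp hq => simp [hp, hq, Finset.sum_add_distrib]
  | mul_X p v hp =>
    simp [Derivation.leibniz, hp, Finset.sum_add_distrib, MvPolynomial.pderiv_X, Pi.single_apply,
      Finset.mul_sum, MvPolynomial.smul_eq_C_mul]
    ring_nf

theorem apolar_linForm_mul (c : V → K) (p f : MvPolynomial V K) :
    apolar (linForm c * p) f = apolar p (dirDeriv c f) := by
  simp only [linForm, Finset.sum_mul, map_sum, LinearMap.sum_apply, dirDeriv_eq_sum,
    ← MvPolynomial.smul_eq_C_mul, smul_mul_assoc, map_smul, LinearMap.smul_apply, apolar_X_mul]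

theorem apolar_linForm_pow_mul (c : V → K) (k : ℕ) (p f : MvPolynomial V K) :
    apolar (linForm c ^ k * p) f = apolar p ((dirDeriv c)^[k] f) := by
  induction k generalizing f with
  | zero => simp
  | succ k ih => rw [pow_succ', mul_assoc, apolar_linForm_mul, ih, Function.iterate_succ_apply]

theorem apolar_mul_linForm (c : V → K) (p f : MvPolynomial V K) :
    apolar p (linForm c * f) = apolar (dirDeriv c p) f := by
  rw [apolar_comm, apolar_linForm_mul, apolar_comm]

theorem eq_zero_of_forall_apolar_eq_zero [CharZero K] {f : MvPolynomial V K}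
    (h : ∀ p, apolar p f = 0) : f = 0 := by
  ext m
  have := h (MvPolynomial.monomial m 1)
  rw [apolar_monomial, one_mul] at this
  exact (mul_eq_zero.mp this).resolve_left
    (Nat.cast_ne_zero.mpr (Finset.prod_ne_zero_iff.mpr fun v _ => Nat.factorial_ne_zero _))

/-- A linear functional vanishing on the monomials outside of a box is given by the apolar pairing
with a polynomial. -/
theorem exists_apolar_eq [CharZero K] (φ : MvPolynomial V K →ₗ[K] K) (N : V → ℕ)
    (hφ : ∀ m : V →₀ ℕ, (∃ v, N v < m v) → φ (MvPolynomial.monomial m 1) = 0) :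
    ∃ f, ∀ p, φ p = apolar p f := by
  classical
  refine ⟨∑ m ∈ Finset.Icc 0 (Finsupp.equivFunOnFinite.symm N), MvPolynomial.monomial m
    (φ (MvPolynomial.monomial m 1) / (∏ v, (m v).factorial : ℕ)), fun p => ?_⟩
  induction p using MvPolynomial.induction_on' with
  | add p q hp hq => rw [map_add, map_add, LinearMap.add_apply, hp, hq]
  | monomial m r =>
    have hm : ((∏ v, (m v).factorial : ℕ) : K) ≠ 0 :=
      Nat.cast_ne_zero.mpr (Finset.prod_ne_zero_iff.mpr fun v _ => Nat.factorial_ne_zero _)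
    rw [apolar_monomial, MvPolynomial.coeff_sum]
    simp only [MvPolynomial.coeff_monomial, Finset.sum_ite_eq', Finset.mem_Icc, zero_le, true_and]
    have h1 : MvPolynomial.monomial m r = r • MvPolynomial.monomial m (1 : K) := by
      simp [MvPolynomial.smul_monomial]
    rw [h1, map_smul, smul_eq_mul]
    split_ifs with h
    · field_simp
    · rw [hφ m, mul_zero, mul_zero]
      by_contra! hc
      exact h fun v => hc v

end Pairing

/-! ### Power ideals and the relations between edge sums. -/

section PostnikovShapiro

variable {K V ι : Type*} [Field K]

/-- The ideal generated by the powers `(∑ v ∈ I, X v) ^ (d I + 1)`. -/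
def powerIdeal (K : Type*) {V : Type*} [Field K] [Fintype V] (d : Finset V → ℕ) :
    Ideal (MvPolynomial V K) :=
  Ideal.span (Set.range fun I : Finset V => linForm (indVec K I) ^ (d I + 1))

theorem linForm_indVec [Fintype V] (I : Finset V) :
    (linForm (indVec K I) : MvPolynomial V K) = ∑ v ∈ I, MvPolynomial.X v := by
  classical
  simp [linForm, indVec, apply_ite, ite_mul, Finset.sum_ite_mem]

/-- The inverse system of the power ideal. -/
theorem mem_powerIdeal_of_forall_apolar_eq_zero [Fintype V] [CharZero K] {d : Finset V → ℕ}
    {p : MvPolynomial V K}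
    (h : ∀ f, (∀ I, (dirDeriv (indVec K I))^[d I + 1] f = 0) → apolar p f = 0) :
    p ∈ powerIdeal K d := by
  by_contra hp
  obtain ⟨φ, hφp, hφ⟩ := Submodule.exists_dual_map_eq_bot_of_notMem
    (p := (powerIdeal K d).restrictScalars K) (x := p) hp inferInstance
  have hφ' : ∀ q ∈ powerIdeal K d, φ q = 0 := fun q hq => by
    have := Submodule.mem_map_of_mem (f := φ) (p := (powerIdeal K d).restrictScalars K) hq
    rwa [hφ, Submodule.mem_bot] at this
  have hgen : ∀ I, linForm (indVec K I) ^ (d I + 1) ∈ powerIdeal K d := fun I =>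
    Ideal.subset_span ⟨I, rfl⟩
  -- Singletons `I` put a power of every variable in the ideal, so the separating functional lives
  -- on a finite box of monomials and is represented by a polynomial.
  obtain ⟨f, hf⟩ := exists_apolar_eq φ (fun v => d {v}) fun m ⟨v, hv⟩ => hφ' _ <| by
    have hX := hgen {v}
    rw [linForm_indVec, Finset.sum_singleton] at hX
    refine Ideal.mem_of_dvd _ ?_ hX
    rw [MvPolynomial.X_pow_eq_monomial, MvPolynomial.monomial_dvd_monomial]
    exact ⟨Or.inr (by simpa [← Finsupp.single_add] using hv), dvd_rfl⟩
  refine hφp ((hf p).trans (h f fun I => eq_zero_of_forall_apolar_eq_zero fun q => ?_))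
  rw [← apolar_linForm_pow_mul, ← hf]
  exact hφ' _ (Ideal.mul_mem_right _ _ (hgen I))

open Classical in
/-- The vector of the linear form `X a - X b`. -/
def edgeVec (K : Type*) [Field K] {V : Type*} (a b : V) (v : V) : K :=
  (if v = a then 1 else 0) - (if v = b then 1 else 0)

theorem sum_edgeVec (a b : V) (I : Finset V) :
    ∑ v ∈ I, edgeVec K a b v = indVec K I a - indVec K I b := by
  classical
  simp [edgeVec, indVec]

theorem linForm_edgeVec [Fintype V] (a b : V) :
    (linForm (edgeVec K a b) : MvPolynomial V K) = MvPolynomial.X a - MvPolynomial.X b := by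
  classical
  simp [linForm, edgeVec, apply_ite (MvPolynomial.C (R := K) (σ := V)), ite_mul, sub_mul]

variable [Fintype ι]

theorem pderiv_aeval_linForm (c : ι → V → K) (e : ι) (p : MvPolynomial V K) :
    MvPolynomial.pderiv e (MvPolynomial.aeval (fun v => linForm fun e => c e v) p) =
      MvPolynomial.aeval (fun v => linForm fun e => c e v) (dirDeriv (c e) p) := by
  classical
  induction p using MvPolynomial.induction_on with
  | C r => simp
  | add p q hp hq => simp only [map_add, hp, hq]
  | mul_X p v hp =>
    have : MvPolynomial.pderiv e (linForm fun e => c e v) = MvPolynomial.C (c e v) := by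
      simp [linForm, MvPolynomial.pderiv_X, Pi.single_apply]
    simp only [map_mul, map_add, Derivation.leibniz, hp, this, MvPolynomial.aeval_X, dirDeriv_X,
      smul_eq_mul, MvPolynomial.aeval_C, MvPolynomial.algebraMap_eq]

/-- Extracting one variable `e` is `pderiv e`, which the chain rule turns into `dirDeriv (c e)` on
`p`, the adjoint of multiplication by `linForm (c e)`. -/
theorem coeff_squarefree_aeval_linForm [Fintype V] (c : ι → V → K) (S : Finset ι) (p : MvPolynomial V K) :
    MvPolynomial.coeff (∑ e ∈ S, Finsupp.single e 1)
      (MvPolynomial.aeval (fun v => linForm fun e => c e v) p) =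
      apolar p (∏ e ∈ S, linForm (c e)) := by
  classical
  induction S using Finset.induction_on generalizing p with
  | empty =>
    rw [Finset.sum_empty, Finset.prod_empty, apolar_comm, ← MvPolynomial.C_1,
      ← MvPolynomial.monomial_zero', apolar_monomial]
    induction p using MvPolynomial.induction_on with
    | C r => simp
    | add p q hp hq => rw [map_add, MvPolynomial.coeff_add, hp, hq, MvPolynomial.coeff_add, mul_add]
    | mul_X p v hp => simp [linForm, ← MvPolynomial.constantCoeff_eq]
  | insert e S he ih =>
    rw [Finset.prod_insert he, apolar_mul_linForm, ← ih, ← pderiv_aeval_linForm,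
      MvPolynomial.coeff_pderiv, Finset.sum_insert he, add_comm]
    have : (∑ i ∈ S, Finsupp.single i 1 : ι →₀ ℕ) e = 0 := by
      rw [Finsupp.finsetSum_apply]
      exact Finset.sum_eq_zero fun i hi => Finsupp.single_eq_of_ne fun h => he (h ▸ hi)
    simp [this]

/-- The Postnikov-Shapiro theorem: a relation between the edge sums modulo the squares of the
variables lies in the power ideal of the cuts. -/
theorem mem_powerIdeal_cutCard [Fintype V] [CharZero K] (a b : ι → V) {p : MvPolynomial V K}
    (hp : ∀ S : Finset ι, MvPolynomial.coeff (∑ e ∈ S, Finsupp.single e 1)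
      (MvPolynomial.aeval (fun v => linForm fun e => edgeVec K (a e) (b e) v) p) = 0) :
    p ∈ powerIdeal K (cutCard Finset.univ a b) := by
  refine mem_powerIdeal_of_forall_apolar_eq_zero fun f hf => ?_
  refine (Submodule.span_le (p := LinearMap.ker (apolar p))).mpr ?_
    (mem_span_prod_of_iterate_dirDeriv _ a b f hf)
  rintro _ ⟨S, -, rfl⟩
  simpa only [linForm_edgeVec, SetLike.mem_coe, LinearMap.mem_ker] using (coeff_squarefree_aeval_linForm _ S p).symm.trans (hp S)

end PostnikovShapiro


/-! ### Exponentials and logarithms of nilpotent and unipotent elements. -/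

section Exponential

variable {A : Type*} [CommRing A] [Algebra ℚ A]

open IsNilpotent in
theorem exists_exp_eq_one_add_add_sq_mul {z : A} (hz : IsNilpotent z) :
    ∃ r, exp z = 1 + z + z ^ 2 * r := by
  obtain ⟨k, hk⟩ := hz
  refine ⟨∑ i ∈ Finset.range k, ((i + 2).factorial : ℚ)⁻¹ • z ^ i, ?_⟩
  rw [exp_eq_sum (k := k + 2) (by rw [pow_add, hk, zero_mul]), Finset.sum_range_succ',
    Finset.sum_range_succ', Finset.mul_sum]
  simp only [mul_smul_comm, ← pow_add, add_comm 2]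
  simp
  ring

open IsNilpotent in
theorem exists_isUnit_exp_sub_one_eq {z : A} (hz : IsNilpotent z) :
    ∃ u, IsUnit u ∧ exp z - 1 = z * u := by
  obtain ⟨r, hr⟩ := exists_exp_eq_one_add_add_sq_mul hz
  exact ⟨1 + z * r, ((Commute.all z r).isNilpotent_mul_right hz).isUnit_one_add, by rw [hr]; ring⟩

open IsNilpotent in
theorem pow_eq_zero_iff_exp_sub_one {z : A} (hz : IsNilpotent z) (k : ℕ) :
    (exp z - 1) ^ k = 0 ↔ z ^ k = 0 := by
  obtain ⟨u, hu, h⟩ := exists_isUnit_exp_sub_one_eq hz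
  rw [h, mul_pow, (hu.pow k).mul_left_eq_zero]

open IsNilpotent in
theorem exp_injOn_isNilpotent {x y : A} (hx : IsNilpotent x) (hy : IsNilpotent y)
    (h : exp x = exp y) : x = y := by
  have hxy : IsNilpotent (x + -y) := (Commute.all _ _).isNilpotent_add hx hy.neg
  have h1 : exp (x + -y) = 1 := by
    rw [exp_add_of_commute (Commute.all _ _) hx hy.neg, h, exp_mul_exp_neg_self hy]
  have h2 := (pow_eq_zero_iff_exp_sub_one hxy 1).mp (by rw [h1, sub_self, pow_one])
  rwa [pow_one, ← sub_eq_add_neg, sub_eq_zero] at h2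

-- The logarithm is built by successive approximation, the error being divisible by ever higher
-- powers of `y - 1`.
open IsNilpotent in
theorem exists_exp_eq_of_isNilpotent_sub_one {y : A} (hy : IsNilpotent (y - 1)) :
    ∃ x, IsNilpotent x ∧ exp x = y := by
  have key : ∀ k : ℕ, ∃ x w, IsNilpotent x ∧ y = exp x + (y - 1) ^ (k + 1) * w := by
    intro k
    induction k with
    | zero => exact ⟨0, 1, IsNilpotent.zero, by simp⟩
    | succ k ih =>
      obtain ⟨x, w, hx, hxw⟩ := ih
      set u := y - 1
      have hz : IsNilpotent (u ^ (k + 1) * (w * exp (-x))) :=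
        (Commute.all _ _).isNilpotent_mul_right (IsNilpotent.pow_succ k hy)
      obtain ⟨r, hr⟩ := exists_exp_eq_one_add_add_sq_mul hz
      -- The correction cancels the error to first order; what remains is divisible by `u ^ (2 * k +
      -- 2)`, from which `u ^ (k + 2)` is split off.
      refine ⟨x + u ^ (k + 1) * (w * exp (-x)),
        - u ^ k * (w * exp (-x)) ^ 2 * r * exp x, (Commute.all _ _).isNilpotent_add hx hz, ?_⟩
      rw [exp_add_of_commute (Commute.all _ _) hx hz, hr]
      have h1 := exp_mul_exp_neg_self hx
      linear_combination hxw - u ^ (k + 1) * w * h1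
  obtain ⟨N, hN⟩ := hy
  obtain ⟨x, w, hx, h⟩ := key N
  exact ⟨x, hx, by rw [h, _root_.pow_succ, hN]; simp⟩

open IsNilpotent in
theorem exp_sum_eq_prod {ι : Type*} (s : Finset ι) (x : ι → A) (h : ∀ i ∈ s, IsNilpotent (x i)) :
    exp (∑ i ∈ s, x i) = ∏ i ∈ s, exp (x i) := by
  classical
  induction s using Finset.induction_on with
  | empty => simp
  | insert i s hi ih =>
    have h' : ∀ j ∈ s, IsNilpotent (x j) := fun j hj => h j (Finset.mem_insert_of_mem hj)
    rw [Finset.sum_insert hi, Finset.prod_insert hi, exp_add_of_commute (Commute.all _ _)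
      (h i (Finset.mem_insert_self i s)) (isNilpotent_sum h'), ih h']

open IsNilpotent in
theorem exp_mem_subalgebra {K : Type*} [Field K] [CharZero K] [Algebra K A] (S : Subalgebra K A)
    {x : A} (hx : x ∈ S) : exp x ∈ S := by
  rw [exp]
  refine S.sum_mem fun i _ => ?_
  have : ((i.factorial : ℚ)⁻¹ • x ^ i : A) = (i.factorial : K)⁻¹ • x ^ i := by
    rw [← Rat.cast_smul_eq_qsmul K]
    simp
  rw [this]
  exact S.smul_mem (S.pow_mem hx i) _

end Exponential

theorem sum_pow_card_succ_eq_zero {A ι : Type*} [CommRing A] (s : Finset ι) (z : ι → A)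
    (h : ∀ i ∈ s, z i ^ 2 = 0) : (∑ i ∈ s, z i) ^ (s.card + 1) = 0 := by
  classical
  induction s using Finset.induction_on with
  | empty => simp
  | insert i s hi ih =>
    rw [Finset.sum_insert hi, Finset.card_insert_of_notMem hi]
    exact (Commute.all _ _).add_pow_eq_zero_of_add_le_succ_of_pow_eq_zero
      (h i (Finset.mem_insert_self i s)) (ih fun j hj => h j (Finset.mem_insert_of_mem hj))
      (by omega)

/-! ### The algebras of a graph and the isomorphism. -/

section Graph

variable (K : Type*) [Field K] {n : ℕ} {ε : Type*} (G : Graph (Fin (n + 1)) ε)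

theorem exists_isLink_lt [G.Loopless] :
    ∃ a b : E(G) → Fin (n + 1), ∀ e, G.IsLink e.1 (a e) (b e) ∧ a e < b e := by
  have h : ∀ e : E(G), ∃ x y, G.IsLink e.1 x y ∧ x < y := fun e => by
    obtain ⟨x, y, hxy⟩ := (G.edge_mem_iff_exists_isLink e.1).mp e.2
    rcases lt_trichotomy x y with hlt | rfl | hlt
    · exact ⟨x, y, hxy, hlt⟩
    · exact absurd hxy (G.not_isLoopAt e.1 x)
    · exact ⟨y, x, hxy.symm, hlt⟩
  choose a b hab using h
  exact ⟨a, b, hab⟩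

variable {G}

theorem prod_gen_sub_one_pow_eq_zero {I : Finset (Fin (n + 1))} (hI : I.Nonempty) :
    (∏ i ∈ I, DAlg.gen K G i - 1) ^ (cut G I + 1) = 0 := by
  have h : q K G I ∈ Ideal.span {p | ∃ I : Finset (Fin (n + 1)), I.Nonempty ∧ p = q K G I} :=
    Ideal.subset_span ⟨I, hI, rfl⟩
  rw [← Ideal.Quotient.eq_zero_iff_mem] at h
  change Ideal.Quotient.mk _ ((∏ i ∈ I, MvPolynomial.X i - 1) ^ (cut G I + 1)) = 0 at h
  rwa [map_pow, map_sub, map_prod, map_one] at h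

theorem DAlg.aeval_gen_surjective :
    Function.Surjective (MvPolynomial.aeval (R := K) (DAlg.gen K G)) := by
  have : MvPolynomial.aeval (R := K) (DAlg.gen K G) = Ideal.Quotient.mkₐ K _ :=
    MvPolynomial.algHom_ext fun i => by simp [DAlg.gen]
  rw [this]
  exact Ideal.Quotient.mkₐ_surjective K _

variable {a b : E(G) → Fin (n + 1)}

theorem coeff_eq_edgeVec (hab : ∀ e, G.IsLink e.1 (a e) (b e) ∧ a e < b e) (i : Fin (n + 1))
    (e : E(G)) : coeff K G i e = edgeVec K (a e) (b e) i := by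
  obtain ⟨hl, hlt⟩ := hab e
  have h1 : (∃ j, G.IsLink e.1 i j ∧ i < j) ↔ i = a e := by
    simp only [hl.isLink_iff]
    refine ⟨?_, fun h => ⟨b e, Or.inl ⟨h.symm, rfl⟩, h ▸ hlt⟩⟩
    rintro ⟨j, ⟨h, -⟩ | ⟨rfl, rfl⟩, hj⟩
    · exact h.symm
    · exact absurd hj hlt.not_gt
  have h2 : (∃ j, G.IsLink e.1 i j ∧ j < i) ↔ i = b e := by
    simp only [hl.isLink_iff]
    refine ⟨?_, fun h => ⟨a e, Or.inr ⟨rfl, h.symm⟩, h ▸ hlt⟩⟩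
    rintro ⟨j, ⟨rfl, rfl⟩ | ⟨-, h⟩, hj⟩
    · exact absurd hj hlt.not_gt
    · exact h.symm
  simp only [coeff, edgeVec, h1, h2]
  by_cases ha : i = a e
  · simp [ha, hlt.ne]
  · by_cases hb : i = b e
    · simp [hb, hlt.ne']
    · simp [ha, hb]

variable [Fintype E(G)]

theorem cut_eq_cutCard (hab : ∀ e, G.IsLink e.1 (a e) (b e) ∧ a e < b e)
    (I : Finset (Fin (n + 1))) : cut G I = cutCard Finset.univ a b I := by
  classical
  rw [cut, cutCard, ← Set.ncard_coe_finset, ← Set.ncard_image_of_injective _ Subtype.val_injective]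
  congr 1
  ext e
  simp only [Set.mem_ofPred_eq, Set.mem_image, Finset.coe_filter, Finset.mem_univ, true_and,
    Subtype.exists, exists_and_right, exists_eq_right]
  constructor
  · rintro ⟨i, hi, j, hj, h⟩
    refine ⟨h.edge_mem, ?_⟩
    rcases (hab ⟨e, h.edge_mem⟩).1.eq_and_eq_or_eq_and_eq h with ⟨h1, h2⟩ | ⟨h1, h2⟩ <;>
      simp [h1, h2, hi, hj]
  · rintro ⟨he, h⟩
    have hl := (hab ⟨e, he⟩).1
    by_cases ha : a ⟨e, he⟩ ∈ I
    · exact ⟨_, ha, _, fun hb => h (by simp [ha, hb]), hl⟩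
    · exact ⟨_, by by_contra hb; exact h (by simp [ha, hb]), _, ha, hl.symm⟩

theorem X_eq_mk_linForm (hab : ∀ e, G.IsLink e.1 (a e) (b e) ∧ a e < b e) (i : Fin (n + 1)) :
    X K G i = Ideal.Quotient.mkₐ K _ (linForm fun e => edgeVec K (a e) (b e) i) := by
  rw [X, linForm, map_sum]
  refine Finset.sum_congr rfl fun e _ => ?_
  rw [coeff_eq_edgeVec K hab, ← MvPolynomial.smul_eq_C_mul, map_smul]
  rfl

theorem coeff_squarefree_eq_zero {ι : Type*} {p : MvPolynomial ι K}
    (hp : p ∈ Ideal.span (Set.range fun e : ι => (MvPolynomial.X e : MvPolynomial ι K) ^ 2))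
    (S : Finset ι) : MvPolynomial.coeff (∑ e ∈ S, Finsupp.single e 1) p = 0 := by
  classical
  have h : (Set.range fun e : ι => (MvPolynomial.X e : MvPolynomial ι K) ^ 2) =
      (fun m => MvPolynomial.monomial m 1) '' Set.range fun e : ι => Finsupp.single e 2 := by
    rw [← Set.range_comp]
    simp [Function.comp_def, MvPolynomial.X_pow_eq_monomial]
  rw [h, MvPolynomial.mem_ideal_span_monomial_image] at hp
  by_contra hS
  obtain ⟨_, ⟨e, rfl⟩, he⟩ := hp _ (MvPolynomial.mem_support_iff.mpr hS)
  have h2 := he e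
  rw [Finsupp.finsetSum_apply, Finsupp.single_eq_same] at h2
  simp only [Finsupp.single_apply, Finset.sum_ite_eq'] at h2
  split_ifs at h2 <;> omega

/-- The relations between the `X_i` are generated by the powers of the cut sums. -/
theorem mem_powerIdeal_of_aeval_X_eq_zero [CharZero K] [G.Loopless]
    {p : MvPolynomial (Fin (n + 1)) K} (hp : MvPolynomial.aeval (X K G) p = 0) :
    p ∈ powerIdeal K (cut G) := by
  obtain ⟨a, b, hab⟩ := exists_isLink_lt G
  rw [show cut G = cutCard Finset.univ a b from funext (cut_eq_cutCard hab)]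
  refine mem_powerIdeal_cutCard a b fun S => coeff_squarefree_eq_zero K ?_ S
  rw [← Ideal.Quotient.eq_zero_iff_mem, ← hp, show X K G = _ from funext (X_eq_mk_linForm K hab),
    ← Ideal.Quotient.mkₐ_eq_mk K, ← MvPolynomial.comp_aeval_apply]

theorem sum_X_pow_cut_succ_eq_zero [G.Loopless] (I : Finset (Fin (n + 1))) :
    (∑ i ∈ I, X K G i) ^ (cut G I + 1) = 0 := by
  classical
  obtain ⟨a, b, hab⟩ := exists_isLink_lt G
  have h : ∑ i ∈ I, X K G i =
      ∑ e ∈ Finset.univ.filter fun e => ¬(a e ∈ I ↔ b e ∈ I),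
        (∑ i ∈ I, coeff K G i e) • phi K G e := by
    rw [Finset.sum_filter_of_ne]
    · simp only [X, Finset.sum_smul]
      exact Finset.sum_comm
    · intro e _ he hsep
      -- An edge inside `I` contributes opposite signs at its ends, so only cut edges survive, each
      -- with square zero.
      have h0 : ∑ i ∈ I, coeff K G i e = 0 := by
        simp only [coeff_eq_edgeVec K hab, sum_edgeVec]
        by_cases hb : b e ∈ I <;> simp [indVec, hsep, hb]
      exact he (by rw [h0, zero_smul])
  rw [h, cut_eq_cutCard hab, cutCard]
  convert sum_pow_card_succ_eq_zero _ _ ?_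
  intro e _
  rw [smul_pow, phi_sq, smul_zero]

variable [CharZero K]

theorem prod_Y_sub_one_pow_eq_zero [G.Loopless] (I : Finset (Fin (n + 1))) :
    (∏ i ∈ I, Y K G i - 1) ^ (cut G I + 1) = 0 := by
  simp only [Y]
  rw [← exp_sum_eq_prod I _ fun i _ => isNilpotent_X K G i,
    pow_eq_zero_iff_exp_sub_one (isNilpotent_sum fun i _ => isNilpotent_X K G i)]
  exact sum_X_pow_cut_succ_eq_zero K I

/-- The homomorphism `D_G → Φ_G` which maps `y_i` to `Y_i`. -/
def DAlg.toPhi [G.Loopless] : DAlg K G →ₐ[K] Phi K G :=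
  Ideal.Quotient.liftₐ _ (MvPolynomial.aeval (Y K G)) <| by
    have : Ideal.span {p | ∃ I : Finset (Fin (n + 1)), I.Nonempty ∧ p = q K G I} ≤
        RingHom.ker (MvPolynomial.aeval (R := K) (Y K G)) := by
      rw [Ideal.span_le]
      rintro _ ⟨I, -, rfl⟩
      simpa [q, RingHom.mem_ker] using prod_Y_sub_one_pow_eq_zero K I
    exact fun p hp => this hp

@[simp]
theorem DAlg.toPhi_gen [G.Loopless] (i : Fin (n + 1)) :
    DAlg.toPhi K (DAlg.gen K G i) = Y K G i :=
  MvPolynomial.aeval_X (Y K G) i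

theorem DAlg.toPhi_comp_aeval [G.Loopless] :
    (DAlg.toPhi K).comp (MvPolynomial.aeval (DAlg.gen K G)) = MvPolynomial.aeval (Y K G) :=
  MvPolynomial.algHom_ext fun i => by simp

theorem DAlg.toPhi_injective [G.Loopless] : Function.Injective (DAlg.toPhi K (G := G)) := by
  have hnil : ∀ i, IsNilpotent (DAlg.gen K G i - 1) := fun i =>
    ⟨_, by simpa using prod_gen_sub_one_pow_eq_zero K (G := G) (Finset.singleton_nonempty i)⟩
  choose x hx hxy using fun i => exists_exp_eq_of_isNilpotent_sub_one (hnil i)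
  have hpow : ∀ I : Finset (Fin (n + 1)), (∑ i ∈ I, x i) ^ (cut G I + 1) = 0 := fun I => by
    -- The power ideal also allows `I = ∅`, where the sum is zero and the exponent positive.
    rcases I.eq_empty_or_nonempty with rfl | hI
    · simp
    · rw [← pow_eq_zero_iff_exp_sub_one (isNilpotent_sum fun i _ => hx i),
        exp_sum_eq_prod I x fun i _ => hx i]
      simp only [hxy]
      exact prod_gen_sub_one_pow_eq_zero K hI
  have hker : powerIdeal K (cut G) ≤ RingHom.ker (MvPolynomial.aeval (R := K) x) := by
    rw [powerIdeal, Ideal.span_le]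
    rintro _ ⟨I, rfl⟩
    simpa [linForm_indVec, RingHom.mem_ker] using hpow I
  -- Both sides are nilpotent with exponential `Y_i`.
  have hX : ∀ i, DAlg.toPhi K (x i) = X K G i := fun i =>
    exp_injOn_isNilpotent ((hx i).map _) (isNilpotent_X K G i) <| by
      rw [← IsNilpotent.map_exp (hx i), hxy, DAlg.toPhi_gen, Y]
  have hsurj : Function.Surjective (MvPolynomial.aeval (R := K) x) := by
    rw [← AlgHom.range_eq_top, eq_top_iff, ← (AlgHom.range_eq_top _).mpr
      (DAlg.aeval_gen_surjective K (G := G)), ← Algebra.adjoin_range_eq_range_aeval,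
      Algebra.adjoin_le_iff]
    rintro _ ⟨i, rfl⟩
    rw [← hxy i]
    exact exp_mem_subalgebra _ ⟨MvPolynomial.X i, by simp⟩
  rw [injective_iff_map_eq_zero]
  intro d hd
  obtain ⟨p, rfl⟩ := hsurj d
  -- A kernel element `p(x)` gives `p(X) = 0`; then `p` is in the power ideal, which already
  -- vanishes at `x`.
  refine hker (mem_powerIdeal_of_aeval_X_eq_zero K ?_)
  rw [← hd, MvPolynomial.comp_aeval_apply]
  simp only [hX]

theorem DAlg.range_toPhi [G.Loopless] : (DAlg.toPhi K (G := G)).range = KAlg K G := by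
  rw [KAlg, Algebra.adjoin_range_eq_range_aeval, ← DAlg.toPhi_comp_aeval, AlgHom.range_comp,
    (AlgHom.range_eq_top _).mpr (DAlg.aeval_gen_surjective K), Algebra.map_top]

/-- The isomorphism `D_G ≃ K_G`. -/
def DAlg.equivKAlg [G.Loopless] : DAlg K G ≃ₐ[K] KAlg K G :=
  (AlgEquiv.ofInjective _ (DAlg.toPhi_injective K)).trans
    (Subalgebra.equivOfEq _ _ (DAlg.range_toPhi K))

theorem DAlg.equivKAlg_gen [G.Loopless] (i : Fin (n + 1)) :
    DAlg.equivKAlg K (DAlg.gen K G i) = KAlg.gen K G i :=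
  Subtype.ext (DAlg.toPhi_gen K i)

end Graph

theorem map_genFiltration {K σ A B : Type*} [Field K] [CommRing A] [CommRing B] [Algebra K A]
    [Algebra K B] (h : A →ₐ[K] B) (a : σ → A) (k : ℕ) :
    (genFiltration K a k).map h.toLinearMap = genFiltration K (h ∘ a) k := by
  rw [genFiltration, genFiltration, ← Submodule.map_comp]
  congr 1
  ext p
  simp [MvPolynomial.comp_aeval_apply, Function.comp_def]

end

end GraphAlg

theorem mainTheorem2 (K : Type*) [Field K] [CharZero K] (n : ℕ) {ε : Type*}
    (G : Graph (Fin (n + 1)) ε) (hV : G.vertexSet = Set.univ) [G.Loopless]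
    [Fintype G.edgeSet] :
    ∃ h : GraphAlg.DAlg K G ≃ₐ[K] GraphAlg.KAlg K G,
      (∀ i : Fin (n + 1), h (GraphAlg.DAlg.gen K G i) = GraphAlg.KAlg.gen K G i) ∧
      ∀ k : ℕ,
        (GraphAlg.genFiltration K (GraphAlg.DAlg.gen K G) k).map h.toLinearMap =
          GraphAlg.genFiltration K (GraphAlg.KAlg.gen K G) k := by
  refine ⟨GraphAlg.DAlg.equivKAlg K, GraphAlg.DAlg.equivKAlg_gen K, fun k => ?_⟩
  have h := GraphAlg.map_genFiltration (GraphAlg.DAlg.equivKAlg K (G := G)).toAlgHom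
    (GraphAlg.DAlg.gen K G) k
  rwa [show (GraphAlg.DAlg.equivKAlg K (G := G)).toAlgHom ∘ GraphAlg.DAlg.gen K G =
    GraphAlg.KAlg.gen K G from funext (GraphAlg.DAlg.equivKAlg_gen K)] at h
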